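/- Let $S=\mathbb C[x_0,x_1,x_2,x_3]$ and let $q\in S$ be a quadratic form of rank $4$. Let $T=\mathbb C[y_0,y_1,y_2,y_3]$ act on $S$ by differentiation, $y_i\mapsto \partial/\partial x_i$. For a form $f\in S$ let $f^\perp=\{g\in T: g(\partial/\partial x_0,\dots,\partial/\partial x_3)(f)=0\}$. A closed subscheme $\Gamma\subset\mathbb P^3$ with saturated homogeneous ideal $I_\Gamma\subset T$ is called apolar to $f$ if $I_\Gamma\subset f^\perp$; a finite scheme $\Gamma$ has length $m$ if its Hilbert polynomial is the constant $m$. Then the rank of $q^2$ is $11$, that is: 1. the minimal length of a smooth finite scheme $\Gamma\subset\mathbb P^3$ apolar to $q^2$ is $11$: there is a smooth apolar scheme of length $11$, and every smooth finite scheme apolar to $q^2$ has length at least $11$ (in particular, none has length $10$); 2. the Waring rank of $q^2$ is $11$: $q^2$ is a sum of $11$ fourth powers of linear forms over $\mathbb C$, and $11$ is the least number of summands for which this is possible. -/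

import Mathlib

/-! Apolarity for forms over `ℂ`, projective subschemes given by saturated homogeneous ideals,
their length and smoothness, and sums of powers of linear forms. -/

noncomputable section

namespace Apolarity

open MvPolynomial
open scoped IsMulCommutative

variable {n : ℕ}

/-- Partial derivatives on a polynomial ring commute. -/
theorem pderiv_comp_comm (i j : Fin n) :
    (pderiv i : Derivation ℂ (MvPolynomial (Fin n) ℂ) _).toLinearMap *
        (pderiv j : Derivation ℂ (MvPolynomial (Fin n) ℂ) _).toLinearMap =
      (pderiv j : Derivation ℂ (MvPolynomial (Fin n) ℂ) _).toLinearMap *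
        (pderiv i : Derivation ℂ (MvPolynomial (Fin n) ℂ) _).toLinearMap := by
  have h : ⁅(pderiv i : Derivation ℂ (MvPolynomial (Fin n) ℂ) (MvPolynomial (Fin n) ℂ)),
      (pderiv j : Derivation ℂ (MvPolynomial (Fin n) ℂ) (MvPolynomial (Fin n) ℂ))⁆ = 0 := by
    apply MvPolynomial.derivation_ext
    intro k
    rw [Derivation.commutator_apply]
    simp only [pderiv_X, Pi.single_apply, Derivation.coe_zero, Pi.zero_apply]
    split_ifs <;> simp
  ext1 m
  refine LinearMap.ext fun r => ?_
  have h2 := congrArg (fun D => D (monomial m r)) h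
  simp only [Derivation.commutator_apply, Derivation.coe_zero, Pi.zero_apply] at h2
  exact sub_eq_zero.mp h2

/-- The commutative algebra of constant coefficient differential operators on
`S = ℂ[x₀, …, xₙ₋₁]`, as a subalgebra of the linear endomorphisms of `S`. -/
abbrev diffAlg (n : ℕ) : Subalgebra ℂ (Module.End ℂ (MvPolynomial (Fin n) ℂ)) :=
  Algebra.adjoin ℂ (Set.range fun i : Fin n =>
    (pderiv i : Derivation ℂ (MvPolynomial (Fin n) ℂ) _).toLinearMap)

instance diffAlg_isMulCommutative (n : ℕ) : IsMulCommutative (diffAlg n) :=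
  Algebra.isMulCommutative_adjoin ℂ (by
    rintro _ ⟨i, rfl⟩ _ ⟨j, rfl⟩
    exact pderiv_comp_comm i j)

/-- The differential operator `g(∂/∂x₀, …, ∂/∂xₙ₋₁)` on `S = ℂ[x₀, …, xₙ₋₁]` attached to
`g ∈ T = ℂ[y₀, …, yₙ₋₁]`. Both `S` and `T` are modelled by `MvPolynomial (Fin n) ℂ`. -/
def diffOp (g : MvPolynomial (Fin n) ℂ) : Module.End ℂ (MvPolynomial (Fin n) ℂ) :=
  (aeval (R := ℂ) (fun i : Fin n => (⟨(pderiv i : Derivation ℂ (MvPolynomial (Fin n) ℂ) _).toLinearMap,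
    Algebra.subset_adjoin ⟨i, rfl⟩⟩ : diffAlg n)) g : diffAlg n)

theorem diffOp_X (i : Fin n) (f : MvPolynomial (Fin n) ℂ) : diffOp (X i) f = pderiv i f := by
  simp [diffOp]

theorem diffOp_C (c : ℂ) (f : MvPolynomial (Fin n) ℂ) : diffOp (C c) f = c • f := by
  simp [diffOp]

theorem diffOp_add (g h f : MvPolynomial (Fin n) ℂ) :
    diffOp (g + h) f = diffOp g f + diffOp h f := by
  simp [diffOp]

theorem diffOp_mul (g h f : MvPolynomial (Fin n) ℂ) :
    diffOp (g * h) f = diffOp g (diffOp h f) := by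
  unfold diffOp
  rw [map_mul]
  rfl

/-- The apolar ideal `f^⊥ ⊆ T`: all `g` with `g(∂/∂x₀, …, ∂/∂xₙ₋₁)(f) = 0`. -/
def apolarIdeal (f : MvPolynomial (Fin n) ℂ) : Ideal (MvPolynomial (Fin n) ℂ) where
  carrier := {g | diffOp g f = 0}
  zero_mem' := by simp [diffOp]
  add_mem' := by
    intro a b ha hb
    simp only [Set.mem_ofPred_eq] at *
    rw [diffOp_add, ha, hb, add_zero]
  smul_mem' := by
    intro c g hg
    simp only [Set.mem_ofPred_eq, smul_eq_mul] at *
    rw [diffOp_mul, hg, map_zero]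

section Subscheme

attribute [local instance] MvPolynomial.gradedAlgebra

/-- A closed subscheme `Γ` of the projective space `ℙⁿ⁻¹` over `ℂ` with homogeneous coordinates
`y₀, …, yₙ₋₁`, given by its saturated homogeneous ideal `I_Γ ⊆ T = ℂ[y₀, …, yₙ₋₁]`.
Saturation with respect to the irrelevant ideal `(y₀, …, yₙ₋₁)` is the condition that `g ∈ I_Γ` as
soon as some power of each `yᵢ` multiplies `g` into `I_Γ`. -/
structure ProjSubscheme (n : ℕ) where
  ideal : Ideal (MvPolynomial (Fin n) ℂ)
  isHomogeneous : ideal.IsHomogeneous (homogeneousSubmodule (Fin n) ℂ)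
  isSaturated : ∀ g : MvPolynomial (Fin n) ℂ,
    (∀ i : Fin n, ∃ k : ℕ, X i ^ k * g ∈ ideal) → g ∈ ideal

end Subscheme

namespace ProjSubscheme

/-- The Hilbert function `d ↦ dim_ℂ (T / I_Γ)_d`. -/
def hilbertFunction (Γ : ProjSubscheme n) (d : ℕ) : ℕ :=
  Module.finrank ℂ
    ((homogeneousSubmodule (Fin n) ℂ d).map (Ideal.Quotient.mkₐ ℂ Γ.ideal).toLinearMap)

/-- `Γ` is a finite scheme of length `m`: its Hilbert polynomial is the constant `m`. -/
def HasLength (Γ : ProjSubscheme n) (m : ℕ) : Prop :=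
  ∃ D : ℕ, ∀ d : ℕ, D ≤ d → Γ.hilbertFunction d = m

/-- The coordinate ring `T / (I_Γ + (yᵢ - 1))` of the affine scheme `Γ ∩ {yᵢ ≠ 0}`. -/
abbrev Chart (Γ : ProjSubscheme n) (i : Fin n) : Type :=
  MvPolynomial (Fin n) ℂ ⧸ (Γ.ideal ⊔ Ideal.span {X i - 1})

/-- `Γ` is smooth over `ℂ`: the coordinate ring of each standard affine chart is a smooth
`ℂ`-algebra. -/
def IsSmooth (Γ : ProjSubscheme n) : Prop :=
  ∀ i : Fin n, Algebra.Smooth ℂ (Γ.Chart i)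

/-- `Γ` is apolar to `f`: its homogeneous ideal is contained in the apolar ideal `f^⊥`. -/
def IsApolarTo (Γ : ProjSubscheme n) (f : MvPolynomial (Fin n) ℂ) : Prop :=
  Γ.ideal ≤ apolarIdeal f

end ProjSubscheme

/-- The lengths of the smooth finite schemes that are apolar to `f`. -/
def smoothApolarLengths (f : MvPolynomial (Fin n) ℂ) : Set ℕ :=
  {m | ∃ Γ : ProjSubscheme n, Γ.IsApolarTo f ∧ Γ.IsSmooth ∧ Γ.HasLength m}

/-- The numbers `r` such that `f` is a sum of the `d`-th powers of `r` linear forms. -/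
def powerSumLengths (d : ℕ) (f : MvPolynomial (Fin n) ℂ) : Set ℕ :=
  {r | ∃ l : Fin r → MvPolynomial (Fin n) ℂ, (∀ k, (l k).IsHomogeneous 1) ∧ f = ∑ k, l k ^ d}

/-- The Hessian matrix of second partial derivatives of a quadratic form; for
`q = ∑ aᵢⱼ xᵢ xⱼ` with `aᵢⱼ = aⱼᵢ` it is the constant matrix `(2 aᵢⱼ)`. -/
def hessian (q : MvPolynomial (Fin n) ℂ) : Matrix (Fin n) (Fin n) ℂ :=
  Matrix.of fun i j => coeff 0 (pderiv i (pderiv j q))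

/-- `q` is a nondegenerate quadratic form, that is, a quadratic form of rank `n`. -/
def IsNondegenerateQuadric (q : MvPolynomial (Fin n) ℂ) : Prop :=
  q.IsHomogeneous 2 ∧ (hessian q).det ≠ 0

end Apolarity

end

/-! Nondegenerate quadrics over `ℂ` are linearly equivalent, so `q` may be taken to be the sum of
four squares.

Lower bound: if `q ^ 2` is the sum of the fourth powers of ten forms `a k`, then `squareRelation a`
is a 10 × 10 idempotent of trace 10, hence the identity. So the `a k` are equiangular: with `ν k = a
k ⬝ᵥ a k`, `ν k ^ 2 = 4/5` and `(a i ⬝ᵥ a j) ^ 2 = ν i * ν j / 6`. A second-moment identity for `a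
0` and `a 1` then yields an integer `E` with `2 * E ^ 2 = 3` (`sqSum_sq_ne_sum_ten`). Fewer forms
are padded with zeros. Upper bound: an explicit sum of eleven powers (`eleven_mem_powerSumLengths`).

Schemes: a smooth scheme has reduced charts, so by the Nullstellensatz its saturated ideal contains
every form vanishing at its points; duality then writes an apolar `f` as a combination of powers of
linear forms at at most `m` points (`mem_powerSumLengths_of_smooth`). Conversely, the forms of a
shortest decomposition are pairwise independent and define a smooth apolar scheme of that length
(`mem_smoothApolarLengths_of_isLeast`). -/

noncomputable section

namespace Apolarity

open MvPolynomial

variable {n : ℕ}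

/-! ### Linear forms, their powers, and the apolarity pairing. -/

/-- The linear form with coefficient vector `a`. -/
def linForm (a : Fin n → ℂ) : MvPolynomial (Fin n) ℂ := ∑ i, C (a i) * X i

theorem linForm_isHomogeneous (a : Fin n → ℂ) : (linForm a).IsHomogeneous 1 :=
  IsHomogeneous.sum _ _ _ fun i _ => isHomogeneous_C_mul_X (a i) i

theorem eval_linForm (a p : Fin n → ℂ) : eval p (linForm a) = ∑ i, a i * p i := by
  simp [linForm]

theorem linForm_smul (c : ℂ) (a : Fin n → ℂ) : linForm (c • a) = C c * linForm a := by
  simp [linForm, Finset.mul_sum, mul_assoc]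

theorem linForm_zero : linForm (0 : Fin n → ℂ) = 0 := by simp [linForm]

theorem pderiv_linForm (a : Fin n → ℂ) (i : Fin n) : pderiv i (linForm a) = C (a i) := by
  classical
  simp [linForm, pderiv_X, Pi.single_apply]

theorem exists_eq_linForm {l : MvPolynomial (Fin n) ℂ} (hl : l.IsHomogeneous 1) :
    ∃ a, l = linForm a := by
  have h : l ∈ homogeneousSubmodule (Fin n) ℂ 1 := hl
  rw [homogeneousSubmodule_one_eq_span_X, Submodule.mem_span_range_iff_exists_fun] at h
  obtain ⟨a, rfl⟩ := h
  exact ⟨a, by simp [linForm, smul_eq_C_mul]⟩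

theorem diffOp_sum_right {ι : Type*} (s : Finset ι) (g : MvPolynomial (Fin n) ℂ)
    (f : ι → MvPolynomial (Fin n) ℂ) : diffOp g (∑ k ∈ s, f k) = ∑ k ∈ s, diffOp g (f k) :=
  map_sum _ _ _

theorem diffOp_C_mul_left (c : ℂ) (g f : MvPolynomial (Fin n) ℂ) :
    diffOp (C c * g) f = c • diffOp g f := by
  rw [diffOp_mul, diffOp_C]

theorem diffOp_zero_left (f : MvPolynomial (Fin n) ℂ) : diffOp 0 f = 0 := by simp [diffOp]

theorem diffOp_sum_left {ι : Type*} (s : Finset ι) (g : ι → MvPolynomial (Fin n) ℂ)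
    (f : MvPolynomial (Fin n) ℂ) : diffOp (∑ k ∈ s, g k) f = ∑ k ∈ s, diffOp (g k) f := by
  classical
  induction s using Finset.induction_on with
  | empty => simp [diffOp_zero_left]
  | insert a s ha ih => rw [Finset.sum_insert ha, Finset.sum_insert ha, diffOp_add, ih]

/-- The operator `f ↦ g(∂) f` as a linear function of `g`. -/
def diffOpLin (f : MvPolynomial (Fin n) ℂ) :
    MvPolynomial (Fin n) ℂ →ₗ[ℂ] MvPolynomial (Fin n) ℂ where
  toFun g := diffOp g f
  map_add' g h := diffOp_add g h f
  map_smul' c g := by rw [smul_eq_C_mul, diffOp_C_mul_left]; rfl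

theorem exists_diffOp_monomial_linForm_pow (a : Fin n → ℂ) (s : Fin n →₀ ℕ) (c : ℂ) :
    ∃ e, (monomial s c).IsHomogeneous e ∧ ∀ d, diffOp (monomial s c) (linForm a ^ d) =
      C (eval a (monomial s c) * (d.descFactorial e)) * linForm a ^ (d - e) := by
  refine induction_on_monomial (motive := fun p => ∃ e, p.IsHomogeneous e ∧ ∀ d,
    diffOp p (linForm a ^ d) = C (eval a p * (d.descFactorial e)) * linForm a ^ (d - e)) ?_ ?_ s c
  · intro c
    exact ⟨0, isHomogeneous_C _ c, fun d => by simp [diffOp_C, smul_eq_C_mul]⟩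
  · rintro p i ⟨e, he, h⟩
    refine ⟨e + 1, he.mul (isHomogeneous_X _ i), fun d => ?_⟩
    rw [diffOp_mul, diffOp_X, Derivation.leibniz_pow, pderiv_linForm]
    cases d with
    | zero => simp
    | succ d =>
      rw [Nat.succ_sub_one, smul_eq_mul, mul_comm, ← smul_eq_C_mul, smul_comm, map_smul,
        map_nsmul, h, Nat.succ_descFactorial_succ, Nat.add_sub_add_right]
      simp only [nsmul_eq_mul, smul_eq_C_mul, map_mul, eval_X, Nat.cast_mul, map_natCast]
      ring

/-- A form `g` of degree `e` acts on powers of a linear form through its value at the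
coefficient vector. -/
theorem diffOp_linForm_pow {g : MvPolynomial (Fin n) ℂ} {e : ℕ} (hg : g.IsHomogeneous e)
    (a : Fin n → ℂ) (d : ℕ) :
    diffOp g (linForm a ^ d) = C (eval a g * (d.descFactorial e)) * linForm a ^ (d - e) := by
  have key : ∀ s ∈ g.support, diffOp (monomial s (coeff s g)) (linForm a ^ d) =
      C (eval a (monomial s (coeff s g)) * (d.descFactorial e)) * linForm a ^ (d - e) := by
    intro s hs
    obtain ⟨e', he', h⟩ := exists_diffOp_monomial_linForm_pow a s (coeff s g)
    have hne : monomial s (coeff s g) ≠ 0 := by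
      simpa using hs
    have : e' = e := he'.inj_right (isHomogeneous_monomial _ (by
      by_contra hcon
      exact (mem_support_iff.mp hs) (hg.coeff_eq_zero hcon))) hne
    subst this
    exact h d
  conv_lhs => rw [g.as_sum]
  rw [diffOp_sum_left, Finset.sum_congr rfl key, ← Finset.sum_mul, ← map_sum, ← Finset.sum_mul,
    ← map_sum, ← g.as_sum]

theorem diffOp_linForm_pow_self {g : MvPolynomial (Fin n) ℂ} {d : ℕ} (hg : g.IsHomogeneous d)
    (a : Fin n → ℂ) : diffOp g (linForm a ^ d) = C (eval a g * d.factorial) := by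
  rw [diffOp_linForm_pow hg]; simp [Nat.descFactorial_self]

/-- The apolarity pairing in degree `d` is nondegenerate. -/
theorem eq_zero_of_coeff_diffOp_eq_zero {d : ℕ} {f : MvPolynomial (Fin n) ℂ}
    (hf : f.IsHomogeneous d)
    (h : ∀ g : MvPolynomial (Fin n) ℂ, g.IsHomogeneous d → coeff 0 (diffOp g f) = 0) : f = 0 := by
  induction d generalizing f with
  | zero =>
    have h1 := h 1 (isHomogeneous_one _ _)
    rw [← C_1, diffOp_C, one_smul] at h1
    have h2 : f.totalDegree = 0 := by
      rw [totalDegree_zero_iff_isHomogeneous]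
      exact hf
    rw [totalDegree_eq_zero_iff_eq_C.mp h2, h1, C_0]
  | succ d ih =>
    have h0 : ∀ i, pderiv i f = 0 := fun i => ih hf.pderiv fun g hg => by
      rw [← diffOp_X, ← diffOp_mul]
      exact h _ (hg.mul (isHomogeneous_X _ i))
    have := hf.sum_X_mul_pderiv
    simp only [h0, mul_zero, Finset.sum_const_zero] at this
    rcases smul_eq_zero.mp this.symm with h | h
    · omega
    · exact h

/-! ### Ten fourth powers do not suffice. -/

section LowerBound

/-- The sum of the squares of the variables. -/
def sqSum (n : ℕ) : MvPolynomial (Fin n) ℂ := ∑ i, X i ^ 2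

theorem pderiv_sqSum (i : Fin n) : pderiv i (sqSum n) = 2 * X i := by
  classical
  rw [sqSum, map_sum, Finset.sum_eq_single i]
  · simp
  · intro j _ hj
    simp [pderiv_X, hj]
  · simp

theorem eval_sqSum (x : Fin n → ℂ) : eval x (sqSum n) = x ⬝ᵥ x := by
  simp [sqSum, dotProduct, sq]

theorem eval_linForm_eq_dotProduct (a x : Fin n → ℂ) : eval x (linForm a) = a ⬝ᵥ x :=
  eval_linForm a x

/-- Apply `∂ᵢ∂ⱼ` to the decomposition and divide by 12. -/
theorem sum_mul_mul_dotProduct_sq {ι : Type*} [Fintype ι] {a : ι → Fin n → ℂ}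
    (h : sqSum n ^ 2 = ∑ k, linForm (a k) ^ 4) (i j : Fin n) (x : Fin n → ℂ) :
    ∑ k, a k i * a k j * (a k ⬝ᵥ x) ^ 2 =
      ((if i = j then 1 else 0) * (x ⬝ᵥ x) + 2 * (x i * x j)) / 3 := by
  have h2 := congrArg (fun p => eval x (pderiv i (pderiv j p))) h
  simp only [map_sum, Derivation.leibniz_pow, pderiv_sqSum, pderiv_linForm, smul_eq_mul,
    Derivation.leibniz, Derivation.map_natCast, nsmul_eq_mul, map_mul, map_pow, map_add,
    eval_sqSum, eval_linForm_eq_dotProduct, pderiv_C, eval_C, eval_X, map_natCast, map_ofNat,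
    pderiv_X, map_zero, mul_zero] at h2
  have h3 : pderiv i (2 : MvPolynomial (Fin n) ℂ) = 0 := (pderiv i).map_natCast 2
  have h4 : ∑ k, a k i * a k j * (a k ⬝ᵥ x) ^ 2 * 12 =
      4 * ((if i = j then 1 else 0) * (x ⬝ᵥ x) + 2 * (x i * x j)) := by
    rcases eq_or_ne i j with rfl | hij
    · simp only [h3, Pi.single_eq_same] at h2
      simp at h2 ⊢
      refine Eq.trans ?_ (Eq.trans h2.symm ?_)
      · exact Finset.sum_congr rfl fun k _ => by ring
      · ring
    · simp only [h3, Pi.single_eq_of_ne hij.symm] at h2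
      simp [hij] at h2 ⊢
      refine Eq.trans ?_ (Eq.trans h2.symm ?_)
      · exact Finset.sum_congr rfl fun k _ => by ring
      · ring
  rw [← Finset.sum_mul] at h4
  linear_combination h4 / 12

theorem sum_dotProduct_mul_dotProduct_mul {ι : Type*} [Fintype ι] (a : ι → Fin n → ℂ)
    (b c : Fin n → ℂ) (y : ι → ℂ) :
    ∑ k, (b ⬝ᵥ a k) * (c ⬝ᵥ a k) * y k = ∑ i, ∑ j, b i * c j * ∑ k, a k i * a k j * y k := by
  simp only [dotProduct, Finset.sum_mul, Finset.mul_sum]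
  conv_rhs => rw [Finset.sum_comm]
  rw [Finset.sum_comm]
  refine Finset.sum_congr rfl fun i _ => ?_
  rw [Finset.sum_comm]
  exact Finset.sum_congr rfl fun j _ => Finset.sum_congr rfl fun k _ => by ring

theorem sum_ite_mul_mul (b c : Fin n → ℂ) (r : ℂ) :
    ∑ i, ∑ j, b i * c j * ((if i = j then 1 else 0) * r) = (b ⬝ᵥ c) * r := by
  simp [dotProduct, Finset.sum_mul, mul_assoc]

variable {ι : Type*} [Fintype ι] {a : ι → Fin 4 → ℂ}

theorem sum_dotProduct_sq_mul_sq (h : sqSum 4 ^ 2 = ∑ k, linForm (a k) ^ 4) (b x : Fin 4 → ℂ) :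
    ∑ k, (b ⬝ᵥ a k) ^ 2 * (a k ⬝ᵥ x) ^ 2 = ((b ⬝ᵥ b) * (x ⬝ᵥ x) + 2 * (b ⬝ᵥ x) ^ 2) / 3 := by
  have h1 := sum_dotProduct_mul_dotProduct_mul a b b fun k => (a k ⬝ᵥ x) ^ 2
  simp only [sum_mul_mul_dotProduct_sq h] at h1
  simp only [sq (b ⬝ᵥ a _)]
  rw [h1]
  simp only [dotProduct, Fin.sum_univ_four, Fin.isValue]
  simp
  ring

/-- Sum the previous moments over the coordinate vectors `x`. Dimension four enters here: the
constant is `(4 + 2) / 3 = 2`. -/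
theorem sum_mul_mul_dotProduct_self (h : sqSum 4 ^ 2 = ∑ k, linForm (a k) ^ 4) (i j : Fin 4) :
    ∑ k, a k i * a k j * (a k ⬝ᵥ a k) = (if i = j then 1 else 0) * 2 := by
  have h1 : ∀ m : Fin 4, ∑ k, a k i * a k j * a k m ^ 2 =
      ((if i = j then 1 else 0) + 2 * ((if i = m then 1 else 0) * (if j = m then 1 else 0))) / 3 := by
    intro m
    have := sum_mul_mul_dotProduct_sq h i j (Pi.single m 1)
    simpa [Pi.single_apply] using this
  have h2 : ∑ k, a k i * a k j * (a k ⬝ᵥ a k) = ∑ m, ∑ k, a k i * a k j * a k m ^ 2 := by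
    rw [Finset.sum_comm]
    refine Finset.sum_congr rfl fun k _ => ?_
    rw [← Finset.mul_sum, dotProduct]
    simp only [sq]
  rw [h2]
  simp only [h1]
  fin_cases i <;> fin_cases j <;> simp [Fin.sum_univ_four] <;> norm_num

theorem sum_dotProduct_mul_mul_self (h : sqSum 4 ^ 2 = ∑ k, linForm (a k) ^ 4) (b c : Fin 4 → ℂ) :
    ∑ k, (b ⬝ᵥ a k) * (c ⬝ᵥ a k) * (a k ⬝ᵥ a k) = 2 * (b ⬝ᵥ c) := by
  rw [sum_dotProduct_mul_dotProduct_mul]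
  simp only [sum_mul_mul_dotProduct_self h, sum_ite_mul_mul]
  ring

theorem sum_dotProduct_self_sq (h : sqSum 4 ^ 2 = ∑ k, linForm (a k) ^ 4) :
    ∑ k, (a k ⬝ᵥ a k) ^ 2 = 8 := by
  have h2 : ∑ k, (a k ⬝ᵥ a k) ^ 2 = ∑ i, ∑ k, a k i * a k i * (a k ⬝ᵥ a k) := by
    rw [Finset.sum_comm]
    refine Finset.sum_congr rfl fun k _ => ?_
    rw [← Finset.sum_mul, sq, dotProduct]
  rw [h2]
  simp only [sum_mul_mul_dotProduct_self h]
  norm_num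

/-- The matrix expressing the squares of the forms `a k` through one another. -/
def squareRelation (a : ι → Fin 4 → ℂ) : Matrix ι ι ℂ :=
  Matrix.of fun i j => 3 / 2 * (a i ⬝ᵥ a j) ^ 2 - 1 / 4 * (a i ⬝ᵥ a i) * (a j ⬝ᵥ a j)

/-- The function `K(b, c) = 3/2 (b·c)² - 1/4 (b·b)(c·c)` is the reproducing kernel of quadratic
forms for the pairing `∑ₖ f(aₖ) g(aₖ)`; idempotence is the reproducing property at the `a k`. -/
theorem squareRelation_mul_self (h : sqSum 4 ^ 2 = ∑ k, linForm (a k) ^ 4) :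
    squareRelation a * squareRelation a = squareRelation a := by
  ext i j
  have h1 := sum_dotProduct_sq_mul_sq h (a i) (a j)
  have h2 := sum_dotProduct_mul_mul_self h (a i) (a i)
  have h3 := sum_dotProduct_mul_mul_self h (a j) (a j)
  have h4 := sum_dotProduct_self_sq h
  have h5 : ∑ k, (3 / 2 * (a i ⬝ᵥ a k) ^ 2 - 1 / 4 * (a i ⬝ᵥ a i) * (a k ⬝ᵥ a k)) *
      (3 / 2 * (a k ⬝ᵥ a j) ^ 2 - 1 / 4 * (a k ⬝ᵥ a k) * (a j ⬝ᵥ a j)) =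
      9 / 4 * (∑ k, (a i ⬝ᵥ a k) ^ 2 * (a k ⬝ᵥ a j) ^ 2)
      - 3 / 8 * (a j ⬝ᵥ a j) * (∑ k, (a i ⬝ᵥ a k) * (a i ⬝ᵥ a k) * (a k ⬝ᵥ a k))
      - 3 / 8 * (a i ⬝ᵥ a i) * (∑ k, (a j ⬝ᵥ a k) * (a j ⬝ᵥ a k) * (a k ⬝ᵥ a k))
      + 1 / 16 * (a i ⬝ᵥ a i) * (a j ⬝ᵥ a j) * ∑ k, (a k ⬝ᵥ a k) ^ 2 := by
    simp only [Finset.mul_sum, ← Finset.sum_sub_distrib, ← Finset.sum_add_distrib]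
    refine Finset.sum_congr rfl fun k _ => ?_
    rw [dotProduct_comm (a j) (a k)]
    ring
  simp only [Matrix.mul_apply, squareRelation, Matrix.of_apply]
  rw [h5, h1, h2, h3, h4]
  ring

/-- The value 10 is the dimension of the space of quadratic forms in four variables. -/
theorem squareRelation_trace (h : sqSum 4 ^ 2 = ∑ k, linForm (a k) ^ 4) :
    (squareRelation a).trace = 10 := by
  have h5 : (squareRelation a).trace = 5 / 4 * ∑ k, (a k ⬝ᵥ a k) ^ 2 := by
    simp only [Matrix.trace, Matrix.diag_apply, squareRelation, Matrix.of_apply, Finset.mul_sum]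
    exact Finset.sum_congr rfl fun k _ => by ring
  rw [h5, sum_dotProduct_self_sq h]
  norm_num

/-- The complementary idempotent has trace zero, so it vanishes in characteristic zero. -/
theorem squareRelation_eq_one {a : Fin 10 → Fin 4 → ℂ}
    (h : sqSum 4 ^ 2 = ∑ k, linForm (a k) ^ 4) : squareRelation a = 1 := by
  have h1 : IsIdempotentElem (1 - squareRelation a) :=
    IsIdempotentElem.one_sub (squareRelation_mul_self h)
  have h2 : IsIdempotentElem (Matrix.toLin' (1 - squareRelation a)) := by
    rw [IsIdempotentElem, Module.End.mul_eq_comp, ← Matrix.toLin'_mul, h1.eq]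
  have h3 : LinearMap.trace ℂ _ (Matrix.toLin' (1 - squareRelation a)) = 0 := by
    rw [Matrix.trace_toLin'_eq, Matrix.trace_sub, squareRelation_trace h]
    simp
  have h4 := LinearMap.IsIdempotentElem.eq_zero_of_trace_eq_zero h2 h3
  exact (sub_eq_zero.mp (Matrix.toLin'.map_eq_zero_iff.mp h4)).symm

/-- The square of a sum of four squares is not a sum of ten fourth powers: ten such forms would
be equiangular with an irrational angle. -/
theorem sqSum_sq_ne_sum_ten (a : Fin 10 → Fin 4 → ℂ) :
    sqSum 4 ^ 2 ≠ ∑ k, linForm (a k) ^ 4 := by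
  intro h
  have hN : ∀ i j, 3 / 2 * (a i ⬝ᵥ a j) ^ 2 - 1 / 4 * (a i ⬝ᵥ a i) * (a j ⬝ᵥ a j) =
      (1 : Matrix (Fin 10) (Fin 10) ℂ) i j := fun i j => by
    rw [← squareRelation_eq_one h]; rfl
  have hν : ∀ i, (a i ⬝ᵥ a i) ^ 2 = 4 / 5 := fun i => by
    have := hN i i
    rw [Matrix.one_apply_eq] at this
    linear_combination 4 / 5 * this
  have hG : ∀ i j, i ≠ j → (a i ⬝ᵥ a j) ^ 2 = (a i ⬝ᵥ a i) * (a j ⬝ᵥ a j) / 6 := fun i j hij => by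
    have := hN i j
    rw [Matrix.one_apply_ne hij] at this
    linear_combination 2 / 3 * this
  -- A square root `p` of `ν 0 * ν 1` is a common unit for the terms below.
  obtain ⟨p, hp⟩ := IsAlgClosed.exists_pow_nat_eq ((a 0 ⬝ᵥ a 0) * (a 1 ⬝ᵥ a 1)) two_pos
  have hp4 : p ^ 4 = 16 / 25 := by
    linear_combination (p ^ 2 + (a 0 ⬝ᵥ a 0) * (a 1 ⬝ᵥ a 1)) * hp + (a 1 ⬝ᵥ a 1) ^ 2 * hν 0 +
      4 / 5 * hν 1
  have hp0 : p ≠ 0 := by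
    rintro rfl
    norm_num at hp4
  -- For `k` equal to 0 or 1 the term is `ν k ^ 2 = 4/5` times `a 0 ⬝ᵥ a 1`. Every other term has
  -- square `(2p/15)²`, so it is `2p/15` up to sign.
  have key : ∀ k, ∃ e : ℤ, (a 0 ⬝ᵥ a k) * (a 1 ⬝ᵥ a k) * (a k ⬝ᵥ a k) =
      (if k = 0 then 4 / 5 * (a 0 ⬝ᵥ a 1) else 0) + (if k = 1 then 4 / 5 * (a 0 ⬝ᵥ a 1) else 0) +
        2 / 15 * p * e := by
    intro k
    by_cases h0 : k = 0
    · refine ⟨0, ?_⟩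
      subst h0
      rw [dotProduct_comm (a 1) (a 0)]
      simp
      linear_combination (a 0 ⬝ᵥ a 1) * hν 0
    by_cases h1 : k = 1
    · refine ⟨0, ?_⟩
      subst h1
      simp
      linear_combination (a 0 ⬝ᵥ a 1) * hν 1
    have h2 : ((a 0 ⬝ᵥ a k) * (a 1 ⬝ᵥ a k) * (a k ⬝ᵥ a k)) ^ 2 = (2 / 15 * p) ^ 2 := by
      rw [mul_pow, mul_pow, hG 0 k (Ne.symm h0), hG 1 k (Ne.symm h1), hν k, mul_pow, hp]
      linear_combination (a 0 ⬝ᵥ a 0) * (a 1 ⬝ᵥ a 1) / 45 * hν k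
    rcases sq_eq_sq_iff_eq_or_eq_neg.mp h2 with h3 | h3
    · exact ⟨1, by simp [h0, h1, h3]⟩
    · exact ⟨-1, by simp [h0, h1, h3]⟩
  choose e he using key
  have h1 := sum_dotProduct_mul_mul_self h (a 0) (a 1)
  simp only [he, Finset.sum_add_distrib, Finset.sum_ite_eq', Finset.mem_univ, if_true,
    ← Finset.mul_sum, ← Int.cast_sum] at h1
  have h2 : p * ((∑ k, e k : ℤ) : ℂ) = 3 * (a 0 ⬝ᵥ a 1) := by linear_combination 15 / 2 * h1
  -- Square `h2` and use `(a 0 ⬝ᵥ a 1) ^ 2 = p ^ 2 / 6`; parity then gives the contradiction.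
  have h3 : (2 * (∑ k, e k) ^ 2 : ℤ) = 3 := by
    have h4 : p ^ 2 * (2 * ((∑ k, e k : ℤ) : ℂ) ^ 2) = p ^ 2 * 3 := by
      have := hG 0 1 (by decide)
      linear_combination 2 * (p * ((∑ k, e k : ℤ) : ℂ) + 3 * (a 0 ⬝ᵥ a 1)) * h2 + 18 * this - 3 * hp
    exact_mod_cast mul_left_cancel₀ (pow_ne_zero 2 hp0) h4
  generalize (∑ k, e k) ^ 2 = z at h3
  omega

end LowerBound

/-! ### Reduction of a nondegenerate quadric to a sum of squares. -/

theorem hessian_isSymm (q : MvPolynomial (Fin n) ℂ) : (hessian q).IsSymm := by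
  ext i j
  have := congrArg (fun D : Module.End ℂ (MvPolynomial (Fin n) ℂ) => coeff 0 (D q))
    (pderiv_comp_comm i j)
  exact this.symm

/-- Euler's relation, for `q` and for its first derivatives. -/
theorem hessian_form {q : MvPolynomial (Fin n) ℂ} (hq : q.IsHomogeneous 2) (x : Fin n → ℂ) :
    ∑ i, ∑ j, x i * hessian q i j * x j = 2 * eval x q := by
  have h1 := congrArg (eval x) hq.sum_X_mul_pderiv
  have h2 : ∀ j, eval x (pderiv j q) = ∑ i, x i * hessian q i j := fun j => by
    have h3 := congrArg (eval x) (hq.pderiv (i := j)).sum_X_mul_pderiv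
    have h4 : ∀ i, pderiv i (pderiv j q) = C (hessian q i j) := fun i => by
      have h5 : (pderiv i (pderiv j q)).totalDegree = 0 := by
        rw [totalDegree_zero_iff_isHomogeneous]
        exact (hq.pderiv (i := j)).pderiv (i := i)
      exact totalDegree_eq_zero_iff_eq_C.mp h5
    simpa [h4] using h3.symm
  simp only [map_sum, map_mul, eval_X, h2, nsmul_eq_mul, map_natCast] at h1
  rw [Finset.sum_comm]
  push_cast at h1
  rw [← h1]
  refine Finset.sum_congr rfl fun j _ => ?_
  rw [Finset.mul_sum]
  exact Finset.sum_congr rfl fun i _ => by ring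

theorem exists_quadraticForm {q : MvPolynomial (Fin n) ℂ} (hq : IsNondegenerateQuadric q) :
    ∃ Q : QuadraticForm ℂ (Fin n → ℂ), (QuadraticMap.associated (R := ℂ) Q).SeparatingLeft ∧
      ∀ x, Q x = 2 * eval x q := by
  have hs : ∀ x y, Matrix.toLinearMap₂' ℂ (hessian q) x y =
      Matrix.toLinearMap₂' ℂ (hessian q) y x := fun x y => by
    rw [Matrix.toLinearMap₂'_apply', Matrix.toLinearMap₂'_apply', Matrix.dotProduct_mulVec,
      ← Matrix.mulVec_transpose, (hessian_isSymm q).eq, dotProduct_comm]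
  refine ⟨LinearMap.BilinMap.toQuadraticMap (Matrix.toLinearMap₂' ℂ (hessian q)), ?_, fun x => ?_⟩
  · rw [QuadraticMap.associated_left_inverse ℂ hs, Matrix.separatingLeft_toLinearMap₂'_iff,
      Matrix.separatingLeft_iff_det_ne_zero]
    exact hq.2
  · rw [← hessian_form hq.1 x, LinearMap.BilinMap.toQuadraticMap_apply, Matrix.toLinearMap₂'_apply]
    refine Finset.sum_congr rfl fun i _ => Finset.sum_congr rfl fun j _ => ?_
    simp only [smul_eq_mul]
    ring

theorem isHomogeneous_aeval_linForm {p : MvPolynomial (Fin n) ℂ} {d : ℕ} (hp : p.IsHomogeneous d)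
    (m : Fin n → Fin n → ℂ) : (aeval (fun i => linForm (m i)) p).IsHomogeneous d := by
  simpa using hp.aeval (fun i => linForm (m i)) fun i => linForm_isHomogeneous (m i)

theorem eval_aeval_eq (x : Fin n → ℂ) (g : Fin n → MvPolynomial (Fin n) ℂ)
    (p : MvPolynomial (Fin n) ℂ) : eval x (aeval g p) = eval (fun i => eval x (g i)) p := by
  induction p using MvPolynomial.induction_on with
  | C c => simp
  | add p q hp hq => rw [map_add, map_add, map_add, hp, hq]
  | mul_X p i hp => rw [map_mul, map_mul, map_mul, hp, aeval_X, eval_X]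

/-- Any two nondegenerate quadrics differ by a linear change of coordinates. -/
theorem exists_aeval_linForm_eq {q₁ q₂ : MvPolynomial (Fin n) ℂ} (h₁ : IsNondegenerateQuadric q₁)
    (h₂ : IsNondegenerateQuadric q₂) :
    ∃ m : Fin n → Fin n → ℂ, aeval (fun i => linForm (m i)) q₂ = q₁ := by
  obtain ⟨Q₁, hQ₁, hx₁⟩ := exists_quadraticForm h₁
  obtain ⟨Q₂, hQ₂, hx₂⟩ := exists_quadraticForm h₂
  obtain ⟨e⟩ := QuadraticForm.equivalent_of_isAlgClosed Q₁ Q₂ hQ₁ hQ₂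
  have he : ∀ x, eval (e x) q₂ = eval x q₁ := fun x => by
    have := e.map_app x
    rw [hx₁, hx₂] at this
    exact mul_left_cancel₀ two_ne_zero this
  -- These are the matrix entries of `e`: the `i`-th linear form evaluates at `x` to `e x i`.
  refine ⟨fun i j => e (fun k => if j = k then 1 else 0) i, MvPolynomial.funext fun x => ?_⟩
  have hx : ∀ i, eval x (linForm fun j => e (fun k => if j = k then 1 else 0) i) = e x i :=
    fun i => by
      have h := congrFun (LinearMap.pi_apply_eq_sum_univ e.toLinearEquiv.toLinearMap x) i
      rw [Finset.sum_apply] at h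
      rw [eval_linForm]
      refine Eq.trans (Finset.sum_congr rfl fun j _ => ?_) h.symm
      exact mul_comm _ _
  rw [← he x, eval_aeval_eq, funext hx]

theorem sqSum_isNondegenerateQuadric : IsNondegenerateQuadric (sqSum n) := by
  classical
  refine ⟨IsHomogeneous.sum _ _ _ fun i _ => isHomogeneous_X_pow i 2, ?_⟩
  have : hessian (sqSum n) = (2 : ℂ) • (1 : Matrix (Fin n) (Fin n) ℂ) := by
    ext i j
    have h3 : pderiv i (2 : MvPolynomial (Fin n) ℂ) = 0 := (pderiv i).map_natCast 2
    simp only [hessian, Matrix.of_apply, pderiv_sqSum, Derivation.leibniz, h3, pderiv_X,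
      Matrix.smul_apply, Matrix.one_apply, Pi.single_apply]
    rcases eq_or_ne i j with rfl | hij
    · have h2 : (2 : MvPolynomial (Fin n) ℂ) = C 2 := (map_ofNat C 2).symm
      simp [h2]
    · simp [hij, hij.symm]
  rw [this, Matrix.det_smul, Matrix.det_one, mul_one]
  exact pow_ne_zero _ two_ne_zero

theorem powerSumLengths_subset_aeval {d : ℕ} {f : MvPolynomial (Fin n) ℂ} (m : Fin n → Fin n → ℂ) :
    powerSumLengths d f ⊆ powerSumLengths d (aeval (fun i => linForm (m i)) f) := by
  rintro r ⟨l, hl, rfl⟩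
  exact ⟨fun k => aeval (fun i => linForm (m i)) (l k),
    fun k => isHomogeneous_aeval_linForm (hl k) m, by simp⟩

theorem powerSumLengths_sq_eq {q₁ q₂ : MvPolynomial (Fin n) ℂ} (h₁ : IsNondegenerateQuadric q₁)
    (h₂ : IsNondegenerateQuadric q₂) (d e : ℕ) :
    powerSumLengths d (q₁ ^ e) = powerSumLengths d (q₂ ^ e) := by
  have key : ∀ {q₁ q₂ : MvPolynomial (Fin n) ℂ}, IsNondegenerateQuadric q₁ →
      IsNondegenerateQuadric q₂ → powerSumLengths d (q₁ ^ e) ⊆ powerSumLengths d (q₂ ^ e) := by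
    intro q₁ q₂ h₁ h₂
    obtain ⟨m, rfl⟩ := exists_aeval_linForm_eq h₂ h₁
    rw [← map_pow]
    exact powerSumLengths_subset_aeval m
  exact subset_antisymm (key h₁ h₂) (key h₂ h₁)

/-! ### Eleven fourth powers suffice, and the Waring rank. -/

/-- A linear combination of `d`-th powers of linear forms is a sum of such powers. -/
theorem card_mem_powerSumLengths {d : ℕ} (hd : d ≠ 0) {ι : Type*} [Fintype ι] (c : ι → ℂ)
    (a : ι → Fin n → ℂ) {r : ℕ} (hr : Fintype.card ι ≤ r) :
    r ∈ powerSumLengths d (∑ k, C (c k) * linForm (a k) ^ d) := by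
  -- Coefficients are absorbed by `d`-th roots; zero forms pad the sum to length `r`.
  choose w hw using fun k => IsAlgClosed.exists_pow_nat_eq (c k) (Nat.pos_of_ne_zero hd)
  obtain ⟨t, rfl⟩ := Nat.exists_eq_add_of_le hr
  refine ⟨Fin.append (fun k => linForm (w ((Fintype.equivFin ι).symm k) •
    a ((Fintype.equivFin ι).symm k))) fun _ => 0, fun k => ?_, ?_⟩
  · refine Fin.addCases (fun i => ?_) (fun i => ?_) k
    · rw [Fin.append_left]; exact linForm_isHomogeneous _
    · rw [Fin.append_right]; exact isHomogeneous_zero _ _ _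
  · rw [Fin.sum_univ_add]
    simp only [Fin.append_left, Fin.append_right, zero_pow hd, Finset.sum_const_zero, add_zero]
    rw [Equiv.sum_comp (Fintype.equivFin ι).symm fun k => linForm (w k • a k) ^ d]
    refine Finset.sum_congr rfl fun k _ => ?_
    rw [linForm_smul, mul_pow, ← map_pow, hw]

/-- Three coordinate vectors and two tetrahedra `(±1, ±1, ±1, t)` with sign product `+1`. The
heights `t = s` and `t = -s(2 - w)` have squares `2 + w` and `2 - w`; the weights make the
`x₀x₁x₂x₃` terms of the tetrahedra cancel. -/
theorem eleven_mem_powerSumLengths : 11 ∈ powerSumLengths 4 (sqSum 4 ^ 2) := by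
  obtain ⟨w, hw⟩ := IsAlgClosed.exists_pow_nat_eq (3 : ℂ) two_pos
  obtain ⟨s, hs⟩ := IsAlgClosed.exists_pow_nat_eq (2 + w) two_pos
  have key : sqSum 4 ^ 2 = ∑ k : Fin 11,
      C ((![2 / 3, 2 / 3, 2 / 3, (3 - w) / 72, (3 - w) / 72, (3 - w) / 72, (3 - w) / 72,
        (3 + w) / 72, (3 + w) / 72, (3 + w) / 72, (3 + w) / 72] : Fin 11 → ℂ) k) *
      linForm ((![![1, 0, 0, 0], ![0, 1, 0, 0], ![0, 0, 1, 0],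
        ![1, 1, 1, s], ![1, -1, -1, s], ![-1, 1, -1, s], ![-1, -1, 1, s],
        ![1, 1, 1, -s * (2 - w)], ![1, -1, -1, -s * (2 - w)], ![-1, 1, -1, -s * (2 - w)],
        ![-1, -1, 1, -s * (2 - w)]] : Fin 11 → Fin 4 → ℂ) k) ^ 4 := by
    refine MvPolynomial.funext fun x => ?_
    rw [map_pow, eval_sqSum]
    simp only [map_sum, map_mul, map_pow, eval_C, eval_linForm, dotProduct]
    simp only [Fin.sum_univ_succ, Fin.sum_univ_zero, Matrix.cons_val_zero, Matrix.cons_val_succ]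
    simp only [Fin.succ_zero_eq_one, Fin.succ_one_eq_two, Fin.isValue]
    generalize x 0 = x₀, x 1 = x₁, x 2 = x₂, x (Fin.succ 2) = x₃
    have hs' : s ^ 2 - (2 + w) = 0 := sub_eq_zero.mpr hs
    have hw' : w ^ 2 - 3 = 0 := sub_eq_zero.mpr hw
    -- Only the coefficients of `x₀x₁x₂x₃`, `xᵢ²x₃²` and `x₃⁴` need the relations for `s` and `w`,
    -- one line of multipliers or more for each.
    linear_combination
      -(96 * s / 72 * x₀ * x₁ * x₂ * x₃) * hw'
      - 24 * (x₀ ^ 2 + x₁ ^ 2 + x₂ ^ 2) * x₃ ^ 2 *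
        ((5 / 24 - w / 8 - w ^ 2 / 72 + w ^ 3 / 72) * hs' + (-1 / 9 + w / 72 + w ^ 2 / 72) * hw')
      - 4 * x₃ ^ 4 *
        ((17 / 24 - 9 / 8 * w + 5 / 9 * w ^ 2 - 5 / 72 * w ^ 4 + w ^ 5 / 72) *
          (s ^ 2 + 2 + w) * hs' +
        (-31 / 36 + 5 / 9 * w + 17 / 72 * w ^ 2 - 13 / 72 * w ^ 3 - w ^ 4 / 72 + w ^ 5 / 72) * hw')
  rw [key]
  exact card_mem_powerSumLengths four_ne_zero _ _ (by simp)

theorem isLeast_powerSumLengths_sq {q : MvPolynomial (Fin 4) ℂ} (hq : IsNondegenerateQuadric q) :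
    IsLeast (powerSumLengths 4 (q ^ 2)) 11 := by
  rw [powerSumLengths_sq_eq hq sqSum_isNondegenerateQuadric]
  refine ⟨eleven_mem_powerSumLengths, ?_⟩
  rintro r ⟨l, hl, h⟩
  by_contra! hr
  choose a ha using fun k => exists_eq_linForm (hl k)
  -- Any shorter sum is padded to exactly ten powers.
  have h10 : 10 ∈ powerSumLengths 4 (∑ k, C (1 : ℂ) * linForm (a k) ^ 4) :=
    card_mem_powerSumLengths four_ne_zero _ _ (by simpa using Nat.le_of_lt_succ hr)
  obtain ⟨l', hl', h'⟩ := h10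
  choose a' ha' using fun k => exists_eq_linForm (hl' k)
  refine sqSum_sq_ne_sum_ten a' ?_
  simp only [← ha', ← h']
  simp [h, ha]

/-! ### Smooth algebras are reduced. -/

section Reduced
open TensorProduct

theorem integralClosure_polynomial_eq_C {K : Type*} [Field K] [IsAlgClosed K] {p : Polynomial K}
    (hp : p ∈ integralClosure K (Polynomial K)) : ∃ c, p = Polynomial.C c := by
  have : Algebra.IsIntegral K (integralClosure K (Polynomial K)) := inferInstance
  obtain ⟨c, hc⟩ := (IsAlgClosed.algebraMap_bijective_of_isIntegral (k := K)
    (K := integralClosure K (Polynomial K))).2 ⟨p, hp⟩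
  exact ⟨c, (congrArg Subtype.val hc).symm⟩

/-- A smooth algebra over an algebraically closed field is reduced. -/
theorem isReduced_of_smooth (K A : Type*) [Field K] [IsAlgClosed K] [CommRing A] [Algebra K A]
    [Algebra.Smooth K A] : IsReduced A := by
  refine ⟨fun a ha => ?_⟩
  -- For nilpotent `a`, `a ⊗ X` is integral over `A`. Integral closure commutes with smooth base
  -- change and `K` is integrally closed in `K[X]`, so `a ⊗ X` comes from `A ⊗ K`; its coefficient
  -- `a` of `X` is then zero.
  have hnil : IsNilpotent (a ⊗ₜ[K] (Polynomial.X : Polynomial K)) := by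
    obtain ⟨k, hk⟩ := ha
    exact ⟨k, by rw [Algebra.TensorProduct.tmul_pow, hk, zero_tmul]⟩
  have hint : IsIntegral A (a ⊗ₜ[K] (Polynomial.X : Polynomial K)) := by
    obtain ⟨k, hk⟩ := hnil
    refine ⟨Polynomial.X ^ k, Polynomial.monic_X_pow k, by simpa using hk⟩
  obtain ⟨z, hz⟩ := (TensorProduct.toIntegralClosure_bijective_of_smooth
    (R := K) (S := A) (B := Polynomial K)).2 ⟨_, hint⟩
  let φ : A ⊗[K] Polynomial K →ₗ[K] A :=
    (TensorProduct.rid K A).toLinearMap ∘ₗ (Polynomial.lcoeff K 1).lTensor A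
  have hφ : ∀ z, φ (TensorProduct.toIntegralClosure K A (Polynomial K) z).1 = 0 := by
    intro z
    induction z with
    | zero => simp
    | add x y hx hy => rw [map_add, AddMemClass.coe_add, map_add, hx, hy, add_zero]
    | tmul b p =>
      obtain ⟨c, hc⟩ := integralClosure_polynomial_eq_C p.2
      simp [φ, TensorProduct.toIntegralClosure, hc]
  have h := hφ z
  rw [hz] at h
  simpa [φ] using h

end Reduced

-- Homogenization, and interpolation by forms.

attribute [local instance] MvPolynomial.gradedAlgebra

/-- The homogenization of `g` in degree `N` with respect to the variable `X i`. -/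
def homogenize (i : Fin n) (N : ℕ) : MvPolynomial (Fin n) ℂ →ₗ[ℂ] MvPolynomial (Fin n) ℂ :=
  ∑ d ∈ Finset.range (N + 1), LinearMap.mulLeft ℂ (X i ^ (N - d)) ∘ₗ homogeneousComponent d

theorem homogenize_apply (i : Fin n) (N : ℕ) (g : MvPolynomial (Fin n) ℂ) :
    homogenize i N g = ∑ d ∈ Finset.range (N + 1), X i ^ (N - d) * homogeneousComponent d g := by
  simp [homogenize]

theorem homogenize_isHomogeneous (i : Fin n) (N : ℕ) (g : MvPolynomial (Fin n) ℂ) :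
    (homogenize i N g).IsHomogeneous N := by
  rw [homogenize_apply]
  refine IsHomogeneous.sum _ _ _ fun d hd => ?_
  have := (isHomogeneous_X_pow (R := ℂ) i (N - d)).mul (homogeneousComponent_isHomogeneous d g)
  rwa [Nat.sub_add_cancel (Nat.le_of_lt_succ (Finset.mem_range.mp hd))] at this

theorem homogenize_of_isHomogeneous (i : Fin n) {N d : ℕ} (hd : d ≤ N)
    {g : MvPolynomial (Fin n) ℂ} (hg : g.IsHomogeneous d) :
    homogenize i N g = X i ^ (N - d) * g := by
  rw [homogenize_apply, Finset.sum_eq_single d]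
  · rw [homogeneousComponent_of_mem hg, if_pos rfl]
  · intro b _ hb
    rw [homogeneousComponent_of_mem hg, if_neg hb, mul_zero]
  · intro h
    exact absurd (Finset.mem_range.mpr (Nat.lt_succ_of_le hd)) h

theorem sum_homogeneousComponent_range {N : ℕ} {g : MvPolynomial (Fin n) ℂ}
    (hN : g.totalDegree ≤ N) : ∑ d ∈ Finset.range (N + 1), homogeneousComponent d g = g := by
  conv_rhs => rw [← sum_homogeneousComponent g]
  symm
  refine Finset.sum_subset (fun d hd => ?_) fun d _ hd => ?_
  · simp only [Finset.mem_range] at *; omega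
  · exact homogeneousComponent_eq_zero _ _ (by simp only [Finset.mem_range] at *; omega)

/-- Homogenization thus kills multiples of `X i - 1`. The strict bound keeps the top component of `X
i * g` from being truncated. -/
theorem homogenize_X_mul (i : Fin n) {N : ℕ} {g : MvPolynomial (Fin n) ℂ}
    (hN : g.totalDegree < N) : homogenize i N (X i * g) = homogenize i N g := by
  rw [← sum_homogeneousComponent_range hN.le, Finset.mul_sum, map_sum, map_sum]
  refine Finset.sum_congr rfl fun d hd => ?_
  have h := homogeneousComponent_isHomogeneous d g
  rcases Nat.lt_or_ge d N with hdN | hdN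
  · rw [homogenize_of_isHomogeneous i hdN.le h,
      homogenize_of_isHomogeneous i (d := 1 + d) (by omega) ((isHomogeneous_X _ i).mul h),
      ← mul_assoc, ← pow_succ]
    congr 2
    omega
  · rw [homogeneousComponent_eq_zero _ _ (by omega), mul_zero]

theorem homogenize_mem {I : Ideal (MvPolynomial (Fin n) ℂ)}
    (hI : I.IsHomogeneous (homogeneousSubmodule (Fin n) ℂ)) {g : MvPolynomial (Fin n) ℂ}
    (hg : g ∈ I) (i : Fin n) (N : ℕ) : homogenize i N g ∈ I := by
  rw [homogenize_apply]
  exact Ideal.sum_mem _ fun d _ =>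
    I.mul_mem_left _ (homogeneousComponent_mem_of_mem hI hg d)

/-- A form that lies in a dehomogenization of a homogeneous ideal lies in that ideal after
multiplication by a power of the variable. -/
theorem exists_X_pow_mul_mem {I : Ideal (MvPolynomial (Fin n) ℂ)}
    (hI : I.IsHomogeneous (homogeneousSubmodule (Fin n) ℂ)) {i : Fin n} {d : ℕ}
    {g : MvPolynomial (Fin n) ℂ} (hg : g.IsHomogeneous d)
    (h : g ∈ I ⊔ Ideal.span {X i - 1}) : ∃ k, X i ^ k * g ∈ I := by
  obtain ⟨a, ha, b, hb, rfl⟩ := Submodule.mem_sup.mp h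
  obtain ⟨c, rfl⟩ := Ideal.mem_span_singleton'.mp hb
  refine ⟨(d + c.totalDegree + 1) - d, ?_⟩
  rw [← homogenize_of_isHomogeneous i (by omega) hg, map_add, mul_sub, mul_one, map_sub,
    mul_comm c, homogenize_X_mul i (by omega), sub_self, add_zero]
  exact homogenize_mem hI ha i _

theorem eval_smul_of_isHomogeneous {g : MvPolynomial (Fin n) ℂ} {d : ℕ} (hg : g.IsHomogeneous d)
    (c : ℂ) (p : Fin n → ℂ) : eval (c • p) g = c ^ d * eval p g := by
  rw [eval_eq, eval_eq, Finset.mul_sum]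
  refine Finset.sum_congr rfl fun s hs => ?_
  have h1 : ∑ i ∈ s.support, s i = d := by
    rw [← hg.degree_eq_sum_deg_support hs]
  simp only [Pi.smul_apply, smul_eq_mul, mul_pow, Finset.prod_mul_distrib]
  rw [Finset.prod_pow_eq_pow_sum, h1]
  ring

theorem eval_smul_eq_zero {I : Ideal (MvPolynomial (Fin n) ℂ)}
    (hI : I.IsHomogeneous (homogeneousSubmodule (Fin n) ℂ)) {p : Fin n → ℂ}
    (hp : ∀ g ∈ I, eval p g = 0) (c : ℂ) : ∀ g ∈ I, eval (c • p) g = 0 := by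
  intro g hg
  rw [← sum_homogeneousComponent g, map_sum]
  refine Finset.sum_eq_zero fun d _ => ?_
  rw [eval_smul_of_isHomogeneous (homogeneousComponent_isHomogeneous d g),
    hp _ (homogeneousComponent_mem_of_mem hI hg d), mul_zero]

/-- In high degree, forms take arbitrary values at finitely many pairwise non-proportional
points. -/
theorem exists_isHomogeneous_eval {ι : Type*} [Fintype ι] {p : ι → Fin n → ℂ}
    (h0 : ∀ k, p k ≠ 0) (hp : ∀ k j, k ≠ j → ∀ c : ℂ, p k ≠ c • p j) {d : ℕ}
    (hd : Fintype.card ι ≤ d) (v : ι → ℂ) :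
    ∃ g : MvPolynomial (Fin n) ℂ, g.IsHomogeneous d ∧ ∀ k, eval (p k) g = v k := by
  classical
  have h1 : ∀ k j, ∃ b : Fin n → ℂ, (k ≠ j → eval (p j) (linForm b) = 0) ∧
      eval (p k) (linForm b) ≠ 0 := by
    intro k j
    by_cases hkj : k = j
    · obtain ⟨i, hi⟩ := Function.ne_iff.mp (h0 k)
      exact ⟨Pi.single i 1, fun h => absurd hkj h, by simpa [eval_linForm, Pi.single_apply] using hi⟩
    · obtain ⟨i, hi⟩ := Function.ne_iff.mp (h0 j)
      obtain ⟨l, hl⟩ := Function.ne_iff.mp (hp k j hkj (p k i / p j i))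
      -- The 2 × 2 minor of `p j` and the variable point in coordinates `i`, `l`; it vanishes at `p
      -- k` only if these coordinates are proportional.
      refine ⟨Pi.single l (p j i) - Pi.single i (p j l), fun _ => ?_, fun h => hl ?_⟩
      · simp [eval_linForm, sub_mul, Pi.single_apply]
        ring
      · simp [eval_linForm, sub_mul, Pi.single_apply] at h
        simp only [Pi.zero_apply] at hi
        rw [Pi.smul_apply, smul_eq_mul]
        field_simp
        linear_combination h
  choose b hb0 hb using h1
  -- Lagrange interpolation: `G k` vanishes at all points but `p k`, and the last factor raises its
  -- degree to `d`.
  let G : ι → MvPolynomial (Fin n) ℂ := fun k =>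
    (∏ j, linForm (b k j)) * linForm (b k k) ^ (d - Fintype.card ι)
  have hG : ∀ k, (G k).IsHomogeneous d := fun k => by
    have h1 := IsHomogeneous.prod Finset.univ (fun j => linForm (b k j)) (fun _ => 1)
      fun j _ => linForm_isHomogeneous _
    have h2 := h1.mul ((linForm_isHomogeneous (b k k)).pow (d - Fintype.card ι))
    have h3 : ∑ _j : ι, 1 + 1 * (d - Fintype.card ι) = d := by
      simp
      omega
    rwa [h3] at h2
  have hGne : ∀ k, eval (p k) (G k) ≠ 0 := fun k => by
    rw [map_mul, map_prod, map_pow]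
    exact mul_ne_zero (Finset.prod_ne_zero_iff.mpr fun j _ => hb k j) (pow_ne_zero _ (hb k k))
  have hGz : ∀ k j, k ≠ j → eval (p j) (G k) = 0 := fun k j hkj => by
    rw [map_mul, map_prod, Finset.prod_eq_zero (Finset.mem_univ j) (hb0 k j hkj), zero_mul]
  refine ⟨∑ k, C (v k / eval (p k) (G k)) * G k, IsHomogeneous.sum _ _ _ fun k _ =>
    (hG k).C_mul _, fun j => ?_⟩
  rw [map_sum, Finset.sum_eq_single j]
  · rw [map_mul, eval_C, div_mul_cancel₀ _ (hGne j)]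
  · intro k _ hkj
    rw [map_mul, hGz k j hkj, mul_zero]
  · simp

/-! ### From smooth apolar schemes to power sums. -/

variable {Γ : ProjSubscheme n} {m : ℕ}

instance finite_homogeneousSubmodule (d : ℕ) :
    Module.Finite ℂ (homogeneousSubmodule (Fin n) ℂ d) :=
  Module.Finite.iff_fg.mpr (homogeneousSubmodule_fg _ _ d)

/-- A finite scheme of length `m` has at most `m` points. -/
theorem card_le_of_hasLength (hm : Γ.HasLength m) {ι : Type*} [Fintype ι] {p : ι → Fin n → ℂ}
    (h0 : ∀ k, p k ≠ 0) (hp : ∀ k j, k ≠ j → ∀ c : ℂ, p k ≠ c • p j)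
    (hΓ : ∀ k, ∀ g ∈ Γ.ideal, eval (p k) g = 0) : Fintype.card ι ≤ m := by
  obtain ⟨D, hD⟩ := hm
  obtain ⟨ev, hev⟩ : ∃ ev : (MvPolynomial (Fin n) ℂ ⧸ Γ.ideal) →ₗ[ℂ] (ι → ℂ),
      ∀ g, ev (Ideal.Quotient.mkₐ ℂ Γ.ideal g) = fun k => eval (p k) g :=
    ⟨LinearMap.pi fun k => (Ideal.Quotient.liftₐ Γ.ideal (aeval (p k)) (hΓ k)).toLinearMap,
      fun g => rfl⟩
  rw [← hD (D + Fintype.card ι) (by omega), ProjSubscheme.hilbertFunction]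
  set V := (homogeneousSubmodule (Fin n) ℂ (D + Fintype.card ι)).map
    (Ideal.Quotient.mkₐ ℂ Γ.ideal).toLinearMap
  have htop : V.map ev = ⊤ := by
    rw [eq_top_iff]
    intro v _
    obtain ⟨g, hg, hv⟩ := exists_isHomogeneous_eval h0 hp (Nat.le_add_left _ D) v
    exact ⟨_, ⟨g, hg, rfl⟩, (hev g).trans (funext hv)⟩
  have h := Submodule.finrank_map_le ev V
  rwa [htop, finrank_top, Module.finrank_fintype_fun_eq_card] at h

/-- The points of a projective scheme. -/
def points (Γ : ProjSubscheme n) : Set (Projectivization ℂ (Fin n → ℂ)) :=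
  {P | ∀ g ∈ Γ.ideal, eval P.rep g = 0}

theorem rep_ne_smul_rep {P Q : Projectivization ℂ (Fin n → ℂ)} (h : P ≠ Q) (c : ℂ) :
    P.rep ≠ c • Q.rep := by
  intro hc
  apply h
  rw [← P.mk_rep, ← Q.mk_rep, Projectivization.mk_eq_mk_iff']
  exact ⟨c, hc.symm⟩

theorem card_le_of_subset_points (hm : Γ.HasLength m)
    {s : Finset (Projectivization ℂ (Fin n → ℂ))} (hs : ↑s ⊆ points Γ) : s.card ≤ m := by
  have := card_le_of_hasLength hm (p := fun P : s => P.1.rep) (fun P => P.1.rep_nonzero)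
    (fun P Q h => rep_ne_smul_rep (fun h' => h (Subtype.ext h'))) (fun P => hs P.2)
  simpa using this

theorem points_finite (hm : Γ.HasLength m) : (points Γ).Finite := by
  by_contra h
  obtain ⟨s, hs, hcard⟩ := Set.Infinite.exists_subset_card_eq h (m + 1)
  have := card_le_of_subset_points hm hs
  omega

/-- In a smooth scheme, forms vanishing at all points belong to the ideal. -/
theorem mem_ideal_of_smooth (hΓ : Γ.IsSmooth) {g : MvPolynomial (Fin n) ℂ} {d : ℕ}
    (hg : g.IsHomogeneous d) (h : ∀ P ∈ points Γ, eval P.rep g = 0) : g ∈ Γ.ideal := by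
  -- By saturation it suffices to work in each chart, whose ideal is radical, so the Nullstellensatz
  -- applies.
  refine Γ.isSaturated g fun i => exists_X_pow_mul_mem Γ.isHomogeneous hg ?_
  have := hΓ i
  have hred : IsReduced (Γ.Chart i) := isReduced_of_smooth ℂ (Γ.Chart i)
  have hrad := (Ideal.isRadical_iff_quotient_reduced _).mpr hred
  rw [← hrad.radical, ← vanishingIdeal_zeroLocus_eq_radical (K := ℂ)]
  intro p hp
  have hpI : ∀ g ∈ Γ.ideal, eval p g = 0 := fun g hg => hp g (Ideal.mem_sup_left hg)
  have hpi : p i = 1 := by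
    have := hp (X i - 1) (Ideal.mem_sup_right (Ideal.mem_span_singleton_self _))
    rw [map_sub, aeval_X, map_one] at this
    exact sub_eq_zero.mp this
  have hp0 : p ≠ 0 := by
    rintro rfl
    simp at hpi
  obtain ⟨c, hc⟩ := Projectivization.exists_smul_eq_mk_rep ℂ p hp0
  have h1 := h (Projectivization.mk ℂ p hp0) (by
    intro g hg
    rw [← hc]
    exact eval_smul_eq_zero Γ.isHomogeneous hpI _ g hg)
  rw [← hc, Units.smul_def, eval_smul_of_isHomogeneous hg] at h1
  exact (mul_eq_zero.mp h1).resolve_left (pow_ne_zero _ c.ne_zero)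

/-- A form is a linear combination of powers of the linear forms attached to the points of a
smooth finite apolar scheme. -/
theorem mem_powerSumLengths_of_smooth {f : MvPolynomial (Fin n) ℂ} {d : ℕ}
    (hf : f.IsHomogeneous d) (hd : d ≠ 0) (hΓf : Γ.IsApolarTo f) (hΓ : Γ.IsSmooth)
    (hm : Γ.HasLength m) : m ∈ powerSumLengths d f := by
  classical
  set s := (points_finite hm).toFinset with hs
  have hmem : ∀ P, P ∈ s ↔ P ∈ points Γ := fun P => by simp [hs]
  have hcard : Fintype.card s ≤ m := by
    simpa using card_le_of_subset_points hm (s := s) (fun P hP => (hmem P).mp hP)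
  let L : s → homogeneousSubmodule (Fin n) ℂ d →ₗ[ℂ] ℂ := fun P =>
    (aeval P.1.rep).toLinearMap ∘ₗ (homogeneousSubmodule (Fin n) ℂ d).subtype
  let K : homogeneousSubmodule (Fin n) ℂ d →ₗ[ℂ] ℂ :=
    lcoeff ℂ 0 ∘ₗ diffOpLin f ∘ₗ (homogeneousSubmodule (Fin n) ℂ d).subtype
  -- A form killed by all point evaluations lies in the ideal of `Γ`, hence in `f^⊥`, so `K` kills
  -- it too.
  have hK : K ∈ Submodule.span ℂ (Set.range L) := by
    refine mem_span_of_iInf_ker_le_ker fun g hg => ?_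
    have hg' : g.1 ∈ Γ.ideal := mem_ideal_of_smooth hΓ g.2 fun P hP =>
      (Submodule.mem_iInf _).mp hg ⟨P, (hmem P).mpr hP⟩
    have h : diffOp g.1 f = 0 := hΓf hg'
    change coeff 0 (diffOp g.1 f) = 0
    rw [h, coeff_zero]
  obtain ⟨c, hc⟩ := (Submodule.mem_span_range_iff_exists_fun ℂ).mp hK
  have hfe : f = ∑ P, C (c P / d.factorial) * linForm P.1.rep ^ d := by
    rw [← sub_eq_zero]
    refine eq_zero_of_coeff_diffOp_eq_zero (d := d) (hf.sub (IsHomogeneous.sum _ _ _ fun P _ =>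
      IsHomogeneous.C_mul ?_ _)) fun g hg => ?_
    · simpa using (linForm_isHomogeneous P.1.rep).pow d
    · have h1 : ∑ P, c P * eval P.1.rep g = coeff 0 (diffOp g f) := by
        have := LinearMap.congr_fun hc ⟨g, hg⟩
        simpa [L, K, diffOpLin, aeval_eq_eval] using this
      rw [map_sub, coeff_sub, diffOp_sum_right, coeff_sum, ← h1, sub_eq_zero]
      refine Finset.sum_congr rfl fun P _ => ?_
      rw [← smul_eq_C_mul, map_smul, coeff_smul, diffOp_linForm_pow_self hg, coeff_C, if_pos rfl,
        smul_eq_mul]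
      field_simp [Nat.cast_ne_zero.mpr d.factorial_ne_zero]
  rw [hfe]
  exact card_mem_powerSumLengths hd _ _ hcard

/-! ### The reduced scheme of finitely many points. -/

/-- Restriction of polynomials to the line spanned by `a`. -/
def lineEval (a : Fin n → ℂ) : MvPolynomial (Fin n) ℂ →ₐ[ℂ] Polynomial ℂ :=
  aeval fun i => Polynomial.X * Polynomial.C (a i)

theorem eval_lineEval (a : Fin n → ℂ) (c : ℂ) (g : MvPolynomial (Fin n) ℂ) :
    (lineEval a g).eval c = eval (c • a) g := by
  induction g using MvPolynomial.induction_on with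
  | C r => simp [lineEval]
  | add p q hp hq => rw [map_add, Polynomial.eval_add, map_add, hp, hq]
  | mul_X p i hp => rw [map_mul, Polynomial.eval_mul, map_mul, hp]; simp [lineEval, mul_comm c]

theorem lineEval_of_isHomogeneous {g : MvPolynomial (Fin n) ℂ} {d : ℕ} (hg : g.IsHomogeneous d)
    (a : Fin n → ℂ) : lineEval a g = Polynomial.C (eval a g) * Polynomial.X ^ d :=
  Polynomial.funext fun c => by
    rw [eval_lineEval, eval_smul_of_isHomogeneous hg]
    rw [Polynomial.eval_mul, Polynomial.eval_C, Polynomial.eval_pow, Polynomial.eval_X, mul_comm]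

theorem coeff_lineEval (a : Fin n → ℂ) (d : ℕ) (g : MvPolynomial (Fin n) ℂ) :
    (lineEval a g).coeff d = eval a (homogeneousComponent d g) := by
  conv_lhs => rw [← sum_homogeneousComponent g]
  rw [map_sum, Polynomial.finsetSum_coeff]
  simp only [lineEval_of_isHomogeneous (homogeneousComponent_isHomogeneous _ g),
    Polynomial.coeff_C_mul_X_pow, Finset.sum_ite_eq]
  split_ifs with h
  · rfl
  · rw [homogeneousComponent_eq_zero _ _ (by simpa using h), map_zero]

section Points

variable {ι : Type*} (p : ι → Fin n → ℂ)

/-- The homogeneous ideal of the points of projective space represented by the vectors `p k`. -/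
def pointsIdeal : Ideal (MvPolynomial (Fin n) ℂ) := ⨅ k, RingHom.ker (lineEval (p k))

variable {p}

theorem mem_pointsIdeal {g : MvPolynomial (Fin n) ℂ} :
    g ∈ pointsIdeal p ↔ ∀ k, lineEval (p k) g = 0 := by
  simp [pointsIdeal, Submodule.mem_iInf, RingHom.mem_ker]

/-- Vanishing on a whole line through the origin separates degrees; this makes `pointsIdeal`
homogeneous. -/
theorem eval_homogeneousComponent_of_mem {g : MvPolynomial (Fin n) ℂ} (hg : g ∈ pointsIdeal p)
    (k : ι) (d : ℕ) : eval (p k) (homogeneousComponent d g) = 0 := by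
  rw [← coeff_lineEval, mem_pointsIdeal.mp hg k, Polynomial.coeff_zero]

theorem mem_pointsIdeal_of_isHomogeneous {g : MvPolynomial (Fin n) ℂ} {d : ℕ}
    (hg : g.IsHomogeneous d) (h : ∀ k, eval (p k) g = 0) : g ∈ pointsIdeal p :=
  mem_pointsIdeal.mpr fun k => by rw [lineEval_of_isHomogeneous hg, h, Polynomial.C_0, zero_mul]

theorem eval_smul_of_mem {g : MvPolynomial (Fin n) ℂ} (hg : g ∈ pointsIdeal p) (k : ι) (c : ℂ) :
    eval (c • p k) g = 0 := by
  rw [← eval_lineEval, mem_pointsIdeal.mp hg k, Polynomial.eval_zero]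

/-- The reduced scheme of finitely many points, represented by nonzero vectors. -/
def pointsScheme (p : ι → Fin n → ℂ) (h0 : ∀ k, p k ≠ 0) : ProjSubscheme n where
  ideal := pointsIdeal p
  isHomogeneous := by
    intro d g hg
    change (DirectSum.decompose (homogeneousSubmodule (Fin n) ℂ) g d : MvPolynomial (Fin n) ℂ) ∈ _
    have : (DirectSum.decompose (homogeneousSubmodule (Fin n) ℂ) g d : MvPolynomial (Fin n) ℂ) =
        homogeneousComponent d g := decomposition.decompose'_apply g d
    rw [this]
    exact mem_pointsIdeal_of_isHomogeneous (homogeneousComponent_isHomogeneous d g) fun k =>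
      eval_homogeneousComponent_of_mem hg k d
  isSaturated := by
    intro g hg
    refine mem_pointsIdeal.mpr fun k => ?_
    obtain ⟨i, hi⟩ := Function.ne_iff.mp (h0 k)
    obtain ⟨e, he⟩ := hg i
    have h := mem_pointsIdeal.mp he k
    rw [map_mul, map_pow] at h
    refine (mul_eq_zero.mp h).resolve_left (pow_ne_zero _ ?_)
    rw [lineEval, aeval_X]
    exact mul_ne_zero Polynomial.X_ne_zero (Polynomial.C_ne_zero.mpr hi)

theorem X_sub_one_dvd_sub_homogenize (i : Fin n) {N : ℕ} {g : MvPolynomial (Fin n) ℂ}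
    (hN : g.totalDegree ≤ N) : X i - 1 ∣ homogenize i N g - g := by
  conv => rhs; rhs; rw [← sum_homogeneousComponent_range hN]
  rw [homogenize_apply, ← Finset.sum_sub_distrib]
  refine Finset.dvd_sum fun d _ => ?_
  have h : X i ^ (N - d) * homogeneousComponent d g - homogeneousComponent d g =
      (X i ^ (N - d) - 1) * homogeneousComponent d g := by ring
  rw [h]
  exact (sub_one_dvd_pow_sub_one _ _).mul_right _

/-- Polynomials vanishing at the points of a chart belong to the ideal of the chart. -/
theorem mem_chart_ideal {i : Fin n} {g : MvPolynomial (Fin n) ℂ}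
    (hg : ∀ k, p k i ≠ 0 → eval ((p k i)⁻¹ • p k) g = 0) :
    g ∈ pointsIdeal p ⊔ Ideal.span {X i - 1} := by
  -- One degree more than needed leaves a factor `X i`, so the homogenization also vanishes at
  -- points outside the chart.
  have hdvd := X_sub_one_dvd_sub_homogenize i (Nat.le_succ g.totalDegree)
  have hG : homogenize i (g.totalDegree + 1) g ∈ pointsIdeal p := by
    have hh := homogenize_isHomogeneous i (g.totalDegree + 1) g
    refine mem_pointsIdeal_of_isHomogeneous hh fun k => ?_
    by_cases hk : p k i = 0
    · rw [homogenize_apply, map_sum]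
      refine Finset.sum_eq_zero fun d _ => ?_
      rcases Nat.lt_or_ge d (g.totalDegree + 1) with hd | hd
      · rw [map_mul, map_pow, eval_X, hk, zero_pow (by omega), zero_mul]
      · rw [homogeneousComponent_eq_zero _ _ (by omega), mul_zero, map_zero]
    · have h1 : eval ((p k i)⁻¹ • p k) (homogenize i (g.totalDegree + 1) g) = 0 := by
        obtain ⟨b, hb⟩ := hdvd
        rw [sub_eq_iff_eq_add.mp hb, map_add, hg k hk, map_mul]
        simp [hk]
      rw [eval_smul_of_isHomogeneous hh] at h1
      exact (mul_eq_zero.mp h1).resolve_left (pow_ne_zero _ (inv_ne_zero hk))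
  have h2 : homogenize i (g.totalDegree + 1) g - g ∈ Ideal.span {X i - 1} :=
    Ideal.mem_span_singleton.mpr hdvd
  rw [← sub_sub_cancel (homogenize i (g.totalDegree + 1) g) g]
  exact Ideal.sub_mem _ (Ideal.mem_sup_left hG) (Ideal.mem_sup_right h2)

variable [Fintype ι] {h0 : ∀ k, p k ≠ 0}

theorem pointsScheme_isApolarTo (d : ℕ) :
    (pointsScheme p h0).IsApolarTo (∑ k, linForm (p k) ^ d) := by
  intro g hg
  change diffOp g _ = 0
  rw [diffOp_sum_right]
  refine Finset.sum_eq_zero fun k _ => ?_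
  rw [← sum_homogeneousComponent g, diffOp_sum_left]
  refine Finset.sum_eq_zero fun e _ => ?_
  rw [diffOp_linForm_pow (homogeneousComponent_isHomogeneous e g),
    eval_homogeneousComponent_of_mem hg, zero_mul, C_0, zero_mul]

theorem pointsScheme_hasLength (hp : ∀ k j, k ≠ j → ∀ c : ℂ, p k ≠ c • p j) :
    (pointsScheme p h0).HasLength (Fintype.card ι) := by
  refine ⟨Fintype.card ι, fun d hd => ?_⟩
  obtain ⟨ev, hev⟩ : ∃ ev : (MvPolynomial (Fin n) ℂ ⧸ pointsIdeal p) →ₗ[ℂ] (ι → ℂ),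
      ∀ g, ev (Ideal.Quotient.mkₐ ℂ (pointsIdeal p) g) = fun k => eval (p k) g :=
    ⟨LinearMap.pi fun k => (Ideal.Quotient.liftₐ (pointsIdeal p) (aeval (p k)) fun g hg => by
        simpa using eval_smul_of_mem hg k 1).toLinearMap, fun g => rfl⟩
  rw [ProjSubscheme.hilbertFunction]
  change Module.finrank ℂ ((homogeneousSubmodule (Fin n) ℂ d).map
    (Ideal.Quotient.mkₐ ℂ (pointsIdeal p)).toLinearMap) = _
  set V := (homogeneousSubmodule (Fin n) ℂ d).map
    (Ideal.Quotient.mkₐ ℂ (pointsIdeal p)).toLinearMap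
  have hinj : Function.Injective (ev.domRestrict V) := by
    rw [← LinearMap.ker_eq_bot, LinearMap.ker_eq_bot']
    rintro ⟨_, g, hg, rfl⟩ h
    have h1 : (fun k => eval (p k) g) = 0 := (hev g).symm.trans h
    exact Subtype.ext (Ideal.Quotient.eq_zero_iff_mem.mpr
      (mem_pointsIdeal_of_isHomogeneous hg (congrFun h1)))
  have hsurj : Function.Surjective (ev.domRestrict V) := fun v => by
    obtain ⟨g, hg, hv⟩ := exists_isHomogeneous_eval h0 hp hd v
    exact ⟨⟨_, g, hg, rfl⟩, (hev g).trans (funext hv)⟩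
  rw [(LinearEquiv.ofBijective _ ⟨hinj, hsurj⟩).finrank_eq, Module.finrank_fintype_fun_eq_card]

theorem pointsScheme_isSmooth (hp : ∀ k j, k ≠ j → ∀ c : ℂ, p k ≠ c • p j) :
    (pointsScheme p h0).IsSmooth := by
  intro i
  -- Evaluation at the points with `i`-th coordinate normalized to 1 identifies the chart with a
  -- finite product of copies of `ℂ`, which is smooth.
  let ev : MvPolynomial (Fin n) ℂ →ₐ[ℂ] ({k // p k i ≠ 0} → ℂ) :=
    AlgHom.pi fun k => aeval ((p k.1 i)⁻¹ • p k.1)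
  have hev : ∀ g k, ev g k = eval ((p k.1 i)⁻¹ • p k.1) g := fun g k => rfl
  have hsurj : Function.Surjective ev := fun v => by
    classical
    obtain ⟨g, hg, hv⟩ := exists_isHomogeneous_eval h0 hp le_rfl
      fun k => if h : p k i ≠ 0 then p k i ^ Fintype.card ι * v ⟨k, h⟩ else 0
    refine ⟨g, funext fun k => ?_⟩
    rw [hev, eval_smul_of_isHomogeneous hg, hv, dif_pos k.2, inv_pow,
      inv_mul_cancel_left₀ (pow_ne_zero _ k.2)]
  have hker : (pointsScheme p h0).ideal ⊔ Ideal.span {X i - 1} = RingHom.ker ev := by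
    refine le_antisymm (sup_le (fun g hg => ?_) ?_) fun g hg => ?_
    · exact funext fun k => eval_smul_of_mem hg k.1 _
    · rw [Ideal.span_singleton_le_iff_mem]
      refine funext fun k => ?_
      rw [hev]
      simp [k.2]
    · exact mem_chart_ideal fun k hk => congrFun hg ⟨k, hk⟩
  have hs : Algebra.Smooth ℂ ({k // p k i ≠ 0} → ℂ) := inferInstance
  exact Algebra.Smooth.of_equiv ((Ideal.quotientEquivAlgOfEq ℂ hker).trans
    (Ideal.quotientKerAlgEquivOfSurjective hsurj)).symm

end Points

/-! ### Shortest power sums and the equality of the two ranks. -/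

/-- A dependent power could be absorbed into the other `r - 1`, contradicting minimality. It is used
to exclude zero and proportional vectors. -/
theorem not_linear_combination_of_isLeast {f : MvPolynomial (Fin n) ℂ} {d r : ℕ} (hd : d ≠ 0)
    (hr : IsLeast (powerSumLengths d f) r) {p : Fin r → Fin n → ℂ}
    (hf : f = ∑ k, linForm (p k) ^ d) (k : Fin r) (w : {x // x ≠ k} → ℂ) :
    linForm (p k) ^ d ≠ ∑ x, C (w x) * linForm (p x.1) ^ d := by
  intro h
  have h1 : f = ∑ x : {x // x ≠ k}, C (w x + 1) * linForm (p x.1) ^ d := by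
    rw [hf, Fintype.sum_eq_add_sum_subtype_ne _ k, h, ← Finset.sum_add_distrib]
    exact Finset.sum_congr rfl fun x _ => by rw [map_add, C_1]; ring
  have h2 : r - 1 ∈ powerSumLengths d f := by
    rw [h1]
    exact card_mem_powerSumLengths hd _ _ (by simp [Fintype.card_subtype_compl])
  have h3 := hr.2 h2
  have h4 := k.pos
  omega

/-- The linear forms of a shortest power sum decomposition define a smooth apolar scheme. -/
theorem mem_smoothApolarLengths_of_isLeast {f : MvPolynomial (Fin n) ℂ} {d r : ℕ} (hd : d ≠ 0)
    (hr : IsLeast (powerSumLengths d f) r) : r ∈ smoothApolarLengths f := by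
  classical
  obtain ⟨l, hl, hf⟩ := hr.1
  choose p hpl using fun k => exists_eq_linForm (hl k)
  simp only [hpl] at hf
  have h0 : ∀ k, p k ≠ 0 := fun k hk =>
    not_linear_combination_of_isLeast hd hr hf k 0 (by simp [hk, linForm_zero, hd])
  have hp : ∀ k j, k ≠ j → ∀ c : ℂ, p k ≠ c • p j := fun k j hkj c hc => by
    refine not_linear_combination_of_isLeast hd hr hf k (Pi.single ⟨j, hkj.symm⟩ (c ^ d)) ?_
    rw [Finset.sum_eq_single ⟨j, hkj.symm⟩]
    · rw [Pi.single_eq_same, hc, linForm_smul, mul_pow, map_pow]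
    · intro x _ hx
      rw [Pi.single_eq_of_ne hx, C_0, zero_mul]
    · simp
  refine ⟨pointsScheme p h0, ?_, pointsScheme_isSmooth hp, ?_⟩
  · rw [hf]
    exact pointsScheme_isApolarTo d
  · simpa using pointsScheme_hasLength (h0 := h0) hp

/-- The least length of a smooth finite apolar scheme is the Waring rank. -/
theorem isLeast_smoothApolarLengths {f : MvPolynomial (Fin n) ℂ} {d r : ℕ}
    (hf : f.IsHomogeneous d) (hd : d ≠ 0) (hr : IsLeast (powerSumLengths d f) r) :
    IsLeast (smoothApolarLengths f) r :=
  ⟨mem_smoothApolarLengths_of_isLeast hd hr, fun _ ⟨_, hΓf, hΓ, hm⟩ =>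
    hr.2 (mem_powerSumLengths_of_smooth hf hd hΓf hΓ hm)⟩

end Apolarity

end

open Apolarity in
theorem mainTheorem6 (q : MvPolynomial (Fin 4) ℂ) (hq : IsNondegenerateQuadric q) :
    IsLeast (smoothApolarLengths (q ^ 2)) 11 ∧ IsLeast (powerSumLengths 4 (q ^ 2)) 11 :=
  ⟨isLeast_smoothApolarLengths (hq.1.pow 2) four_ne_zero (isLeast_powerSumLengths_sq hq),
    isLeast_powerSumLengths_sq hq⟩
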